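/- Let $D$ and $U$ be the linear operators on polynomials in $t$ given by $D(t^k)=[k]_q\,t^{k-1}$ and $U(t^k)=t^{k+1}$ for $k\ge 0$, where $[k]_q=\frac{1-q^k}{1-q}=1+q+\dots+q^{k-1}$ (so $D(1)=0$), and for $n\ge 0$ set $$Q_n(t,q)=(D+UDU)^n\,1,\qquad R_n(t,q)=(D+DUU)^n\,1 .$$ A signed permutation of size $n$ is a permutation $\pi$ of $\{-n,\dots,-1\}\cup\{1,\dots,n\}$ such that $\pi(-i)=-\pi(i)$ for all $i$; write $\pi_i=\pi(i)$. It is cycle-alternating if every $i\in\{-n,\dots,-1\}\cup\{1,\dots,n\}$ satisfies either $\pi^{-1}(i)<i>\pi(i)$ or $\pi^{-1}(i)>i<\pi(i)$. Let $\mathcal{C}_n$ be the set of cycle-alternating signed permutations of size $n$. For $\pi\in\mathcal{C}_n$ let $\mathrm{neg}(\pi)$ be the number of $i\in\{1,\dots,n\}$ with $\pi_i<0$, and let $\mathrm{cro}(\pi)$ be the number of crossings of $\pi$, i.e. of pairs $(i,j)$ of elements of $\{-n,\dots,-1\}\cup\{1,\dots,n\}$ such that $i<j<\pi(i)<\pi(j)$.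 Then for every $n\ge 0$, $$Q_n(t,q)=\sum_{\pi\in\mathcal{C}_n}t^{\mathrm{neg}(\pi)}q^{\mathrm{cro}(\pi)},\qquad R_n(t,q)=\sum_{\substack{\pi\in\mathcal{C}_{n+1}\\ \pi_{n+1}<0}}t^{\mathrm{neg}(\pi)-1}q^{\mathrm{cro}(\pi)} .$$ Moreover, the second identity remains true when the condition $\pi_{n+1}<0$ is replaced with $\pi^{-1}(n+1)<0$. -/

import Mathlib

open Polynomial

noncomputable section

/-- The `q`-integer `[n]_q = 1 + q + ⋯ + q ^ (n - 1)`, that is `(1 - q ^ n) / (1 - q)`. -/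
def qInt {R : Type*} [CommRing R] (q : R) (n : ℕ) : R :=
  ∑ i ∈ Finset.range n, q ^ i

theorem one_sub_mul_qInt {R : Type*} [CommRing R] (q : R) (n : ℕ) :
    (1 - q) * qInt q n = 1 - q ^ n :=
  mul_neg_geom_sum q n

/-- The `q`-derivative (Jackson derivative): the `R`-linear operator on `R[t]` with
`D (t ^ n) = [n]_q * t ^ (n - 1)` (so that `D 1 = 0`, because `[0]_q = 0`). -/
def opD {R : Type*} [CommRing R] (q : R) : Module.End R R[X] :=
  (Polynomial.basisMonomials R).constr R fun n => C (qInt q n) * X ^ (n - 1)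

/-- The operator of multiplication by the variable: `U (t ^ n) = t ^ (n + 1)`. -/
def opU (R : Type*) [CommRing R] : Module.End R R[X] :=
  LinearMap.mulLeft R X

theorem opD_X_pow {R : Type*} [CommRing R] (q : R) (n : ℕ) :
    opD q (X ^ n) = C (qInt q n) * X ^ (n - 1) := by
  have h := (Polynomial.basisMonomials R).constr_basis R
    (fun n => C (qInt q n) * (X : R[X]) ^ (n - 1)) n
  rw [Polynomial.coe_basisMonomials] at h
  rw [← Polynomial.monomial_one_right_eq_X_pow]
  exact h

theorem opU_X_pow (R : Type*) [CommRing R] (n : ℕ) :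
    opU R (X ^ n) = X ^ (n + 1) :=
  (pow_succ' X n).symm

/-- `Q_n(t, q) = (D + UDU)^n 1`, a polynomial in `t` with coefficients in `R ∋ q`. -/
def qPolyQ {R : Type*} [CommRing R] (q : R) (n : ℕ) : R[X] :=
  ((opD q + opU R * opD q * opU R) ^ n) 1

/-- `R_n(t, q) = (D + DUU)^n 1`, a polynomial in `t` with coefficients in `R ∋ q`. -/
def qPolyR {R : Type*} [CommRing R] (q : R) (n : ℕ) : R[X] :=
  ((opD q + opD q * opU R * opU R) ^ n) 1

/-- The ordered set `{-n, …, -1} ∪ {1, …, n}`. -/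
abbrev SignedIdx (n : ℕ) : Type :=
  {i : ℤ // i ∈ (Finset.Icc (-(n : ℤ)) (n : ℤ)).erase 0}

namespace SignedIdx

/-- The involution `i ↦ -i`. -/
def opp {n : ℕ} (i : SignedIdx n) : SignedIdx n :=
  ⟨-(i : ℤ), by
    have h := i.2
    simp only [Finset.mem_erase, Finset.mem_Icc] at h ⊢
    omega⟩

/-- The element `n + 1` of `{-(n + 1), …, -1} ∪ {1, …, n + 1}`. -/
def top (n : ℕ) : SignedIdx (n + 1) :=
  ⟨((n + 1 : ℕ) : ℤ), by
    simp only [Finset.mem_erase, Finset.mem_Icc]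
    omega⟩

end SignedIdx

/-- Signed permutations of size `n`: the permutations `π` of `{-n, …, -1} ∪ {1, …, n}` with
`π (-i) = -π i` for all `i`. -/
abbrev SignedPerm (n : ℕ) : Type :=
  {π : Equiv.Perm (SignedIdx n) // ∀ i, π i.opp = (π i).opp}

namespace SignedPerm

/-- The number of `i ∈ {1, …, n}` with `π i < 0`. -/
def neg {n : ℕ} (π : SignedPerm n) : ℕ :=
  (Finset.univ.filter fun i : SignedIdx n => 0 < (i : ℤ) ∧ (π.1 i : ℤ) < 0).card

/-- `i` is a cycle peak of `π` if `π⁻¹ i < i > π i`. -/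
abbrev IsCyclePeak {n : ℕ} (π : SignedPerm n) (i : SignedIdx n) : Prop :=
  π.1.symm i < i ∧ i > π.1 i

/-- `i` is a cycle valley of `π` if `π⁻¹ i > i < π i`. -/
abbrev IsCycleValley {n : ℕ} (π : SignedPerm n) (i : SignedIdx n) : Prop :=
  π.1.symm i > i ∧ i < π.1 i

/-- The set of cycle-alternating signed permutations of size `n`: every `i` in
`{-n, …, -1} ∪ {1, …, n}` is a cycle peak or a cycle valley. -/
def cycleAlternating (n : ℕ) : Finset (SignedPerm n) :=
  Finset.univ.filter fun π => ∀ i, π.IsCyclePeak i ∨ π.IsCycleValley i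

/-- The number of crossings of `π`: pairs `(i, j)` of elements of `{-n, …, -1} ∪ {1, …, n}` with
`i < j < π i < π j`. -/
def cro {n : ℕ} (π : SignedPerm n) : ℕ :=
  (Finset.univ.filter fun p : SignedIdx n × SignedIdx n =>
    p.1 < p.2 ∧ p.2 < π.1 p.1 ∧ π.1 p.1 < π.1 p.2).card

end SignedPerm

end

/-!
In a cycle-alternating signed permutation `π`, exactly one of `i`, `-i` is a cycle valley, so the
set `V` of cycle valleys is a transversal for the pairs `{i, -i}`, and `π` is determined by its
increasing arcs: they match each cycle peak `p ∉ V` with `π⁻¹ p ∈ V`, where `π⁻¹ p < p`, and the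
remaining arcs are their images under `i ↦ -i`. Conversely every such matching comes from a
cycle-alternating signed permutation (`SignedPerm.exists_toMatching_eq`), and `cro` only involves
increasing arcs.

For fixed `V`, choose the partners of the peaks from left to right. If `h` unmatched valleys lie to
the left of a peak, its possible partners contribute `0, …, h - 1` crossings, hence a factor
`[h]_q` whatever was chosen before (`sum_matchings`). This gives the sum of `q ^ cro π` over the
`π` with valley set `V` as a product of `q`-integers (`SignedPerm.sum_pow_cro_eq_prod`).

Reading `V` from the outside inwards, record an up-step when the negative one of the two elements
of a pair belongs to `V` and a down-step otherwise. The peak of that pair then contributes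
`[h + 1]_q` for an up-step and `[h]_q` for a down-step leaving height `h`, and the final height is
`neg π` (`SignedPerm.neg_add_downCount`). These are the coefficients of
`D + UDU : t ^ h ↦ [h]_q t ^ (h - 1) + [h + 1]_q t ^ (h + 1)`, which gives the formula for `Q_n`.

The condition `π (n + 1) < 0` says that the arc starting at `-(n + 1)` ends at a positive element,
i.e. that negative peaks may not choose the smallest valley. With heights lowered by one, the
weights become those of `D + DUU`. Both cases are treated together by a parameter `e`, the number
of smallest elements forbidden to negative peaks (`SignedPerm.sum_admissible_eq_pathPoly`,
`pathPoly_succ`). Finally `π ↦ π⁻¹` preserves `neg` and `cro` and exchanges the conditions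
`π (n + 1) < 0` and `π⁻¹ (n + 1) < 0`.
-/

/-! ### Weighted enumeration of matchings -/

section Matching

variable {R : Type*} [CommRing R] {α : Type*} [LinearOrder α]

/-- Counting the elements of a finite set of size `n` by the number of larger ones gives `[n]_q`. -/
theorem sum_pow_card_gt (q : R) (E : Finset α) :
    ∑ a ∈ E, q ^ (E.filter fun c => a < c).card = qInt q E.card := by
  induction E using Finset.induction_on_min with
  | empty => simp [qInt]
  | insert a s ha ih =>
    have has : a ∉ s := fun h => lt_irrefl _ (ha a h)
    rw [Finset.sum_insert has, Finset.card_insert_of_notMem has]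
    have h1 : ((insert a s).filter fun c => a < c) = s := by
      ext c
      simp only [Finset.mem_filter, Finset.mem_insert]
      constructor
      · rintro ⟨rfl | h, h'⟩
        · exact absurd h' (lt_irrefl _)
        · exact h
      · exact fun h => ⟨Or.inr h, ha c h⟩
    have h2 : ∀ x ∈ s, ((insert a s).filter fun c => x < c) = s.filter fun c => x < c := by
      intro x hx
      rw [Finset.filter_insert, if_neg (ha x hx).not_gt]
    rw [h1, Finset.sum_congr rfl fun x hx => by rw [h2 x hx], ih, qInt, qInt,
      Finset.sum_range_succ, add_comm]

variable [Fintype α]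

open Classical in
/-- The injections `g` of the finset `B` of closers into the finset `A` of openers such that
`g p` is an opener admissible for `p`, in the sense of the relation `r p`. Such an injection is
encoded as a function on the whole type that is the identity outside `B`. -/
noncomputable def matchings (r : α → α → Prop) (A B : Finset α) : Finset (α → α) :=
  Finset.univ.filter fun g =>
    (∀ p ∈ B, g p ∈ A ∧ r p (g p)) ∧ Set.InjOn g B ∧ ∀ p ∉ B, g p = p

open Classical in
/-- The sum over the closers `p`, in increasing order, of the number of openers that are admissible
for `p`, exceed the opener `g p` chosen for `p`, and have not been used by a smaller closer. -/
noncomputable def matchingCode (r : α → α → Prop) (A B : Finset α) (g : α → α) : ℕ :=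
  ∑ p ∈ B, (A.filter fun c => r p c ∧ g p < c ∧ ∀ p' ∈ B, p' < p → g p' ≠ c).card

theorem mem_matchings {r : α → α → Prop} {A B : Finset α} {g : α → α} :
    g ∈ matchings r A B ↔
      (∀ p ∈ B, g p ∈ A ∧ r p (g p)) ∧ Set.InjOn g B ∧ ∀ p ∉ B, g p = p := by
  simp [matchings]

theorem update_mem_matchings {r : α → α → Prop} {A B : Finset α} {b a : α} (hb : b ∉ B)
    (ha : a ∈ A) (hr : r b a) {g : α → α} (hg : g ∈ matchings r (A.erase a) B) :
    Function.update g b a ∈ matchings r A (insert b B) := by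
  rw [mem_matchings] at hg ⊢
  obtain ⟨h1, h2, h3⟩ := hg
  have hne : ∀ p ∈ B, p ≠ b := fun p hp h => hb (h ▸ hp)
  refine ⟨fun p hp => ?_, ?_, fun p hp => ?_⟩
  · rcases Finset.mem_insert.1 hp with rfl | hp
    · simpa using ⟨ha, hr⟩
    · rw [Function.update_of_ne (hne p hp)]
      exact ⟨Finset.mem_of_mem_erase (h1 p hp).1, (h1 p hp).2⟩
  · rw [Finset.coe_insert, Set.injOn_insert (by simpa using hb)]
    refine ⟨fun x hx y hy hxy => ?_, ?_⟩
    · rw [Function.update_of_ne (hne x hx), Function.update_of_ne (hne y hy)] at hxy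
      exact h2 hx hy hxy
    · rintro ⟨x, hx, hxa⟩
      rw [Function.update_of_ne (hne x hx), Function.update_self] at hxa
      exact Finset.ne_of_mem_erase (h1 x hx).1 hxa
  · rw [Finset.mem_insert, not_or] at hp
    rw [Function.update_of_ne hp.1, h3 p hp.2]

theorem update_self_mem_matchings {r : α → α → Prop} {A B : Finset α} {b : α} (hb : b ∉ B)
    {g : α → α} (hg : g ∈ matchings r A (insert b B)) :
    Function.update g b b ∈ matchings r (A.erase (g b)) B := by
  rw [mem_matchings] at hg ⊢
  obtain ⟨h1, h2, h3⟩ := hg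
  have hne : ∀ p ∈ B, p ≠ b := fun p hp h => hb (h ▸ hp)
  refine ⟨fun p hp => ?_, fun x hx y hy hxy => ?_, fun p hp => ?_⟩
  · rw [Function.update_of_ne (hne p hp)]
    have := h1 p (Finset.mem_insert_of_mem hp)
    refine ⟨Finset.mem_erase.2 ⟨fun h => hne p hp ?_, this.1⟩, this.2⟩
    exact h2 (by simp [hp]) (by simp) h
  · rw [Function.update_of_ne (hne x hx), Function.update_of_ne (hne y hy)] at hxy
    exact h2 (by simp [Finset.mem_coe.1 hx]) (by simp [Finset.mem_coe.1 hy]) hxy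
  · by_cases hpb : p = b
    · subst hpb; simp
    · rw [Function.update_of_ne hpb, h3 p (by simp [hpb, hp])]

open Classical in
theorem matchingCode_update {r : α → α → Prop} {A B : Finset α} {b a : α}
    (hb : ∀ p ∈ B, b < p) (g : α → α) :
    matchingCode r A (insert b B) (Function.update g b a) =
      ((A.filter (r b)).filter fun c => a < c).card + matchingCode r (A.erase a) B g := by
  have hbB : b ∉ B := fun h => lt_irrefl _ (hb b h)
  rw [matchingCode, matchingCode, Finset.sum_insert hbB, Function.update_self]
  congr 1
  · rw [Finset.filter_filter]
    congr 1
    refine Finset.filter_congr fun c _ => ?_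
    have : ∀ p' ∈ insert b B, p' < b → Function.update g b a p' ≠ c := by
      intro p' hp' hlt
      rcases Finset.mem_insert.1 hp' with rfl | h
      · exact absurd hlt (lt_irrefl _)
      · exact absurd hlt (hb p' h).not_gt
    tauto
  · refine Finset.sum_congr rfl fun p hp => ?_
    rw [Function.update_of_ne (hb p hp).ne']
    congr 1
    ext c
    simp only [Finset.mem_filter, Finset.mem_erase, Finset.forall_mem_insert,
      Function.update_self]
    have h1 : (∀ x ∈ B, x < p → Function.update g b a x ≠ c) ↔ ∀ x ∈ B, x < p → g x ≠ c :=
      forall₂_congr fun x hx => by rw [Function.update_of_ne (hb x hx).ne']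
    rw [h1]
    have := hb p hp
    constructor
    · rintro ⟨h1, h2, h3, h4, h5⟩
      exact ⟨⟨(h4 this).symm, h1⟩, h2, h3, h5⟩
    · rintro ⟨⟨h4, h1⟩, h2, h3, h5⟩
      exact ⟨h1, h2, h3, fun _ => h4.symm, h5⟩

open Classical in
/-- Matching the closers in increasing order, the closer `p` has as many choices as there are
admissible openers not yet used, and the ranks of these choices are recorded by `matchingCode`.
Monotonicity of `r` makes every opener used earlier admissible for `p`, so that the number of
choices does not depend on the choices made before. -/
theorem sum_matchings (q : R) {r : α → α → Prop} (hr : ∀ a p p', p ≤ p' → r p a → r p' a)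
    (A B : Finset α) :
    ∑ g ∈ matchings r A B, q ^ matchingCode r A B g =
      ∏ p ∈ B, qInt q ((A.filter (r p)).card - (B.filter fun p' => p' < p).card) := by
  induction B using Finset.induction_on_min generalizing A with
  | empty =>
    have : matchings r A ∅ = {id} := by
      ext g
      simp [mem_matchings, funext_iff]
    simp [this, matchingCode]
  | insert b B hb ih =>
    have hbB : b ∉ B := fun h => lt_irrefl _ (hb b h)
    -- A matching amounts to the opener `a` of the smallest closer `b` and a matching of the rest.
    have h1 : ∑ g ∈ matchings r A (insert b B), q ^ matchingCode r A (insert b B) g =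
        ∑ x ∈ (A.filter (r b)).sigma fun a => matchings r (A.erase a) B,
          q ^ ((A.filter (r b)).filter fun c => x.1 < c).card *
            q ^ matchingCode r (A.erase x.1) B x.2 := by
      symm
      refine Finset.sum_nbij' (fun x => Function.update x.2 b x.1)
        (fun g => ⟨g b, Function.update g b b⟩) ?_ ?_ ?_ ?_ ?_
      · rintro ⟨a, g⟩ h
        simp only [Finset.mem_sigma, Finset.mem_filter] at h
        exact update_mem_matchings hbB h.1.1 h.1.2 h.2
      · intro g hg
        simp only [Finset.mem_sigma, Finset.mem_filter]
        exact ⟨(mem_matchings.1 hg).1 b (by simp), update_self_mem_matchings hbB hg⟩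
      · rintro ⟨a, g⟩ h
        simp only [Finset.mem_sigma, Finset.mem_filter] at h
        have := (mem_matchings.1 h.2).2.2 b hbB
        simp only [Function.update_self, Function.update_idem]
        congr
        exact Function.update_eq_self_iff.2 this.symm
      · intro g hg
        simp
      · rintro ⟨a, g⟩ h
        simp only
        rw [matchingCode_update hb, pow_add]
    rw [h1, Finset.sum_sigma, Finset.prod_insert hbB]
    have h2 : ((insert b B).filter fun p' => p' < b) = ∅ := by
      refine Finset.filter_false_of_mem fun p hp => ?_
      rcases Finset.mem_insert.1 hp with rfl | h
      · exact lt_irrefl _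
      · exact (hb p h).not_gt
    rw [h2, Finset.card_empty, Nat.sub_zero, ← sum_pow_card_gt, Finset.sum_mul]
    refine Finset.sum_congr rfl fun a ha => ?_
    rw [Finset.mem_filter] at ha
    have h3 : ∑ g ∈ matchings r (A.erase a) B,
        q ^ ((A.filter (r b)).filter fun c => a < c).card * q ^ matchingCode r (A.erase a) B g =
        q ^ ((A.filter (r b)).filter fun c => a < c).card *
          ∑ g ∈ matchings r (A.erase a) B, q ^ matchingCode r (A.erase a) B g :=
      (Finset.mul_sum _ _ _).symm
    refine h3.trans ?_
    rw [ih]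
    congr 1
    refine Finset.prod_congr rfl fun p hp => ?_
    congr 1
    -- For `p > b`, removing `a` and `b` lowers both cardinalities by one.
    rw [Finset.filter_insert, if_pos (hb p hp), Finset.card_insert_of_notMem (by simp [hbB]),
      Finset.filter_erase, Finset.card_erase_of_mem]
    · omega
    · exact Finset.mem_filter.2 ⟨ha.1, hr a b p (hb p hp).le ha.2⟩

end Matching

/-! ### Weighted lattice paths -/

section Path

variable {R : Type*} [CommRing R]

/-- The number of up-steps with index in `[e, i)` of the path whose up-steps are indexed by `T`. -/
def upCount (T : Finset ℕ) (e i : ℕ) : ℕ :=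
  (T.filter fun j => e ≤ j ∧ j < i).card

/-- The number of down-steps with index less than `i` of the path whose up-steps are indexed
by `T`. -/
def downCount (T : Finset ℕ) (i : ℕ) : ℕ :=
  ((Finset.range i).filter fun j => j ∉ T).card

/-- The weight of the step of index `i` of the path whose up-steps are indexed by `T`, where
for a down-step the first `e` steps are not counted as up-steps. The subtractions are truncated, but
a path on which one of them truncates has a step of weight zero. -/
def stepWeight (q : R) (e : ℕ) (T : Finset ℕ) (i : ℕ) : R :=
  if i ∈ T then qInt q (upCount T 0 i + 1 - downCount T i)
  else qInt q (upCount T e i - downCount T i)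

/-- The product of the weights of the first `N` steps. -/
def pathWeight (q : R) (e N : ℕ) (T : Finset ℕ) : R :=
  ∏ i ∈ Finset.range N, stepWeight q e T i

/-- The generating polynomial of the paths of length `N`, counted by weight and final height
above level `e`. -/
noncomputable def pathPoly (q : R) (e N : ℕ) : R[X] :=
  ∑ T ∈ (Finset.range N).powerset,
    C (pathWeight q e N T) * X ^ (upCount T 0 N - downCount T N - e)

theorem upCount_succ (T : Finset ℕ) {e i : ℕ} (h : e ≤ i) :
    upCount T e (i + 1) = upCount T e i + if i ∈ T then 1 else 0 := by
  have : (T.filter fun j => e ≤ j ∧ j < i + 1) =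
      (T.filter fun j => e ≤ j ∧ j < i) ∪ T.filter fun j => j = i := by
    ext j
    simp only [Finset.mem_filter, Finset.mem_union]
    constructor
    · rintro ⟨h1, h2, h3⟩
      rcases Nat.lt_succ_iff_lt_or_eq.1 h3 with h4 | h4 <;> tauto
    · rintro (⟨h1, h2, h3⟩ | ⟨h1, rfl⟩)
      · exact ⟨h1, h2, by omega⟩
      · exact ⟨h1, h, by omega⟩
  rw [upCount, this, Finset.card_union_of_disjoint, upCount, Finset.filter_eq']
  · split_ifs <;> simp
  · rw [Finset.disjoint_filter]
    intro j _ h1 h2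
    omega

theorem downCount_succ (T : Finset ℕ) (i : ℕ) :
    downCount T (i + 1) = downCount T i + if i ∈ T then 0 else 1 := by
  rw [downCount, Finset.range_add_one, Finset.filter_insert, downCount]
  by_cases h : i ∈ T <;> simp [h]

theorem upCount_insert (T : Finset ℕ) {e i N : ℕ} (h : i ≤ N) :
    upCount (insert N T) e i = upCount T e i := by
  rw [upCount, Finset.filter_insert, if_neg (by omega), upCount]

theorem downCount_insert (T : Finset ℕ) {i N : ℕ} (h : i ≤ N) :
    downCount (insert N T) i = downCount T i := by
  rw [downCount, downCount]
  congr 1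
  refine Finset.filter_congr fun j hj => ?_
  rw [Finset.mem_range] at hj
  rw [Finset.mem_insert, not_or]
  exact ⟨fun h => h.2, fun h' => ⟨by omega, h'⟩⟩

theorem pathWeight_insert (q : R) (e N : ℕ) (T : Finset ℕ) :
    pathWeight q e N (insert N T) = pathWeight q e N T := by
  refine Finset.prod_congr rfl fun i hi => ?_
  rw [Finset.mem_range] at hi
  have : i ∈ insert N T ↔ i ∈ T := by
    rw [Finset.mem_insert]
    exact ⟨fun h => h.resolve_left (by omega), Or.inr⟩
  simp only [stepWeight, upCount_insert T hi.le, downCount_insert T hi.le, this]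

theorem qInt_zero (q : R) : qInt q 0 = 0 := by simp [qInt]

/-- A path with non-zero weight starts with `e` up-steps and stays at height at least `e` after
them. -/
theorem pathWeight_eq_zero_or (q : R) {e : ℕ} (he : e ≤ 1) (T : Finset ℕ) {N : ℕ} (hN : e ≤ N) :
    pathWeight q e N T = 0 ∨
      upCount T e N + e = upCount T 0 N ∧ downCount T N + e ≤ upCount T 0 N := by
  induction N, hN using Nat.le_induction with
  | base =>
    interval_cases e
    · right
      simp [upCount, downCount]
    · have h0 : upCount T 0 0 = 0 ∧ upCount T 1 0 = 0 ∧ upCount T 1 1 = 0 ∧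
          downCount T 0 = 0 := by
        simp only [upCount, downCount, Finset.card_eq_zero, Finset.filter_eq_empty_iff,
          Finset.range_zero, Finset.notMem_empty, false_implies, implies_true, and_true]
        refine ⟨?_, ?_, ?_⟩ <;> intros <;> omega
      by_cases h : 0 ∈ T
      · right
        have h1 := upCount_succ T (le_refl 0)
        have h2 := downCount_succ T 0
        simp only [h, if_true, zero_add] at h1 h2
        omega
      · left
        simp [pathWeight, stepWeight, h, h0.2.1, qInt_zero]
  | succ N hN ih =>
    rw [pathWeight, Finset.prod_range_succ]
    rcases ih with ih | ⟨ih1, ih2⟩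
    · left
      rw [pathWeight] at ih
      rw [ih, zero_mul]
    · rw [upCount_succ T hN, upCount_succ T (Nat.zero_le N), downCount_succ]
      by_cases h : N ∈ T
      · right
        simp only [h, if_true]
        omega
      · by_cases h0 : upCount T e N - downCount T N = 0
        · left
          rw [stepWeight, if_neg h, h0, qInt_zero, mul_zero]
        · right
          simp only [h, if_false]
          omega

/-- Appending a step to the paths of length `N` amounts to applying an operator `Φ` whose
coefficients on `X ^ k` are the weights of the two steps leaving height `k + e`. -/
theorem pathPoly_succ (q : R) {e : ℕ} (he : e ≤ 1) {N : ℕ} (hN : e ≤ N) (Φ : Module.End R R[X])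
    (hΦ : ∀ k, Φ (X ^ k) =
      C (qInt q k) * X ^ (k - 1) + C (qInt q (k + 1 + e)) * X ^ (k + 1)) :
    pathPoly q e (N + 1) = Φ (pathPoly q e N) := by
  rw [pathPoly, Finset.range_add_one, Finset.sum_powerset_insert (by simp), pathPoly, map_sum,
    ← Finset.sum_add_distrib]
  refine Finset.sum_congr rfl fun T hT => ?_
  have hNT : N ∉ T := fun h => by simpa using Finset.mem_powerset.1 hT h
  have hw : ∀ T', pathWeight q e (N + 1) T' = pathWeight q e N T' * stepWeight q e T' N :=
    fun T' => Finset.prod_range_succ _ _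
  rw [hw, hw, pathWeight_insert, ← smul_eq_C_mul (pathWeight q e N T), map_smul, hΦ,
    upCount_succ _ (Nat.zero_le N), upCount_succ _ (Nat.zero_le N), downCount_succ,
    downCount_succ, upCount_insert T le_rfl, downCount_insert T le_rfl, stepWeight, stepWeight,
    upCount_insert T le_rfl, downCount_insert T le_rfl]
  simp only [hNT, Finset.mem_insert_self, if_true, if_false]
  rcases pathWeight_eq_zero_or q he T hN with h | ⟨h1, h2⟩
  · simp [h]
  · obtain ⟨k, hk⟩ := Nat.exists_eq_add_of_le h2
    have e1 : upCount T e N - downCount T N = k := by omega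
    have e2 : upCount T 0 N + 0 - (downCount T N + 1) - e = k - 1 := by omega
    have e3 : upCount T 0 N + 1 - downCount T N = k + 1 + e := by omega
    have e4 : upCount T 0 N + 1 - (downCount T N + 0) - e = k + 1 := by omega
    have e5 : upCount T 0 N - downCount T N - e = k := by omega
    rw [e1, e2, e3, e4, e5, smul_eq_C_mul, C_mul, C_mul]
    ring

theorem opU_C_mul (c : R) (p : R[X]) : opU R (C c * p) = C c * opU R p := by
  rw [← smul_eq_C_mul, map_smul, smul_eq_C_mul]

theorem pathPoly_zero_eq_qPolyQ (q : R) (n : ℕ) : pathPoly q 0 n = qPolyQ q n := by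
  induction n with
  | zero => simp [pathPoly, qPolyQ, pathWeight, upCount, downCount]
  | succ n ih =>
    rw [pathPoly_succ q (Nat.zero_le 1) (Nat.zero_le n) (opD q + opU R * opD q * opU R), ih,
      qPolyQ, qPolyQ, pow_succ']
    · rfl
    · intro k
      simp [opD_X_pow, opU_X_pow, opU_C_mul]

theorem pathPoly_one_eq_qPolyR (q : R) (n : ℕ) : pathPoly q 1 (n + 1) = qPolyR q n := by
  induction n with
  | zero =>
    rw [pathPoly, zero_add, Finset.range_one, ← insert_empty_eq,
      Finset.sum_powerset_insert (by simp)]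
    simp [qPolyR, pathWeight, stepWeight, upCount, downCount, qInt, Finset.filter_singleton]
  | succ n ih =>
    rw [pathPoly_succ q le_rfl (Nat.le_add_left 1 n) (opD q + opD q * opU R * opU R), ih,
      qPolyR, qPolyR, pow_succ']
    · rfl
    · intro k
      simp [opD_X_pow, opU_X_pow]

end Path

/-! ### Cycle-alternating signed permutations as matchings -/

namespace SignedIdx

variable {n : ℕ}

theorem coe_opp (i : SignedIdx n) : (i.opp : ℤ) = -(i : ℤ) := rfl

theorem opp_opp (i : SignedIdx n) : i.opp.opp = i :=
  Subtype.ext (neg_neg _)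

theorem opp_injective : Function.Injective (opp : SignedIdx n → SignedIdx n) :=
  Function.LeftInverse.injective opp_opp

theorem opp_lt_opp {i j : SignedIdx n} : i.opp < j.opp ↔ j < i := by
  rw [← Subtype.coe_lt_coe, ← Subtype.coe_lt_coe, coe_opp, coe_opp, neg_lt_neg_iff]

theorem coe_bounds (i : SignedIdx n) : (i : ℤ) ≠ 0 ∧ -(n : ℤ) ≤ i ∧ (i : ℤ) ≤ n := by
  have h := i.2
  simpa only [Finset.mem_erase, Finset.mem_Icc] using h

theorem exists_coe_eq {z : ℤ} (h0 : z ≠ 0) (h1 : -(n : ℤ) ≤ z) (h2 : z ≤ n) :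
    ∃ i : SignedIdx n, (i : ℤ) = z :=
  ⟨⟨z, by simp [h0, h1, h2]⟩, rfl⟩

/-- A set containing exactly one of `i` and `-i` for every `i`. -/
def IsTransversal (V : Finset (SignedIdx n)) : Prop :=
  ∀ v, v.opp ∈ V ↔ v ∉ V

theorem IsTransversal.opp_mem_compl {V : Finset (SignedIdx n)} (hV : IsTransversal V)
    {v : SignedIdx n} : v.opp ∈ Vᶜ ↔ v ∈ V := by
  rw [Finset.mem_compl, hV, not_not]

end SignedIdx

namespace SignedPerm

open SignedIdx

variable {n : ℕ}

theorem symm_opp (π : SignedPerm n) (i : SignedIdx n) : π.1.symm i.opp = (π.1.symm i).opp := by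
  rw [Equiv.symm_apply_eq, π.2, Equiv.apply_symm_apply]

theorem mem_cycleAlternating {π : SignedPerm n} :
    π ∈ cycleAlternating n ↔ ∀ i, π.IsCyclePeak i ∨ π.IsCycleValley i := by
  simp [cycleAlternating]

/-- The function sending each element outside `V` to its preimage under `π`. -/
def toMatching (V : Finset (SignedIdx n)) (π : SignedPerm n) (p : SignedIdx n) : SignedIdx n :=
  if p ∈ V then p else π.1.symm p

/-- The inverse of the signed permutation with set of cycle valleys `V` recovered from its values
outside `V`, as a plain function. -/
def ofMatchingFun (V : Finset (SignedIdx n)) (g : SignedIdx n → SignedIdx n) (p : SignedIdx n) :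
    SignedIdx n :=
  if p ∈ V then (g p.opp).opp else g p

theorem symm_mem_of_valley_iff {V : Finset (SignedIdx n)} {π : SignedPerm n}
    (hπ : π ∈ cycleAlternating n) (h : ∀ v, π.IsCycleValley v ↔ v ∈ V) {p : SignedIdx n}
    (hp : p ∉ V) : π.1.symm p ∈ V ∧ π.1.symm p < p := by
  rw [mem_cycleAlternating] at hπ
  have h1 : π.1.symm p < p := ((hπ p).resolve_right fun h' => hp ((h p).1 h')).1
  refine ⟨(h _).1 ((hπ _).resolve_left fun h' => ?_), h1⟩
  have := h'.2
  rw [Equiv.apply_symm_apply] at this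
  exact this.not_gt h1

theorem toMatching_mem {V : Finset (SignedIdx n)} {r : SignedIdx n → SignedIdx n → Prop}
    {π : SignedPerm n} (hπ : π ∈ cycleAlternating n) (h : ∀ v, π.IsCycleValley v ↔ v ∈ V)
    (hr : ∀ p ∉ V, r p (π.1.symm p)) : toMatching V π ∈ matchings r V Vᶜ := by
  rw [mem_matchings]
  refine ⟨fun p hp => ?_, fun x hx y hy hxy => ?_, fun p hp => ?_⟩
  · rw [Finset.mem_compl] at hp
    rw [toMatching, if_neg hp]
    exact ⟨(symm_mem_of_valley_iff hπ h hp).1, hr p hp⟩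
  · rw [Finset.mem_coe, Finset.mem_compl] at hx hy
    rw [toMatching, toMatching, if_neg hx, if_neg hy] at hxy
    exact π.1.symm.injective hxy
  · rw [Finset.mem_compl, not_not] at hp
    rw [toMatching, if_pos hp]

theorem toMatching_injective {V : Finset (SignedIdx n)} (hV : IsTransversal V) :
    Function.Injective (toMatching V) := by
  intro π ρ h
  have h1 : ∀ p ∉ V, π.1.symm p = ρ.1.symm p := by
    intro p hp
    have := congrFun h p
    rwa [toMatching, toMatching, if_neg hp, if_neg hp] at this
  have h2 : ∀ p, π.1.symm p = ρ.1.symm p := by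
    intro p
    by_cases hp : p ∈ V
    · have : p.opp ∉ V := by rwa [hV, not_not]
      apply opp_injective
      rw [← symm_opp, ← symm_opp, h1 _ this]
    · exact h1 p hp
  apply Subtype.ext
  rw [← Equiv.symm_symm π.1, ← Equiv.symm_symm ρ.1]
  exact congrArg Equiv.symm (Equiv.ext h2)

theorem ofMatchingFun_mem_iff {V : Finset (SignedIdx n)} (hV : IsTransversal V)
    {r : SignedIdx n → SignedIdx n → Prop} {g : SignedIdx n → SignedIdx n}
    (hg : g ∈ matchings r V Vᶜ) (p : SignedIdx n) : ofMatchingFun V g p ∈ V ↔ p ∉ V := by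
  have h := (mem_matchings.1 hg).1
  by_cases hp : p ∈ V
  · rw [ofMatchingFun, if_pos hp, hV]
    have := (h p.opp (hV.opp_mem_compl.2 hp)).1
    tauto
  · rw [ofMatchingFun, if_neg hp]
    have := (h p (Finset.mem_compl.2 hp)).1
    tauto

theorem ofMatchingFun_opp {V : Finset (SignedIdx n)} (hV : IsTransversal V)
    (g : SignedIdx n → SignedIdx n) (p : SignedIdx n) :
    ofMatchingFun V g p.opp = (ofMatchingFun V g p).opp := by
  by_cases hp : p ∈ V
  · have : p.opp ∉ V := by rwa [hV, not_not]
    rw [ofMatchingFun, ofMatchingFun, if_pos hp, if_neg this, opp_opp]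
  · rw [ofMatchingFun, ofMatchingFun, if_neg hp, if_pos ((hV p).2 hp), opp_opp]

theorem ofMatchingFun_injective {V : Finset (SignedIdx n)} (hV : IsTransversal V)
    {r : SignedIdx n → SignedIdx n → Prop} {g : SignedIdx n → SignedIdx n}
    (hg : g ∈ matchings r V Vᶜ) : Function.Injective (ofMatchingFun V g) := by
  intro x y hxy
  have hiff : x ∈ V ↔ y ∈ V := by
    have := ofMatchingFun_mem_iff hV hg x
    rw [hxy, ofMatchingFun_mem_iff hV hg y] at this
    tauto
  have hinj := (mem_matchings.1 hg).2.1
  by_cases hx : x ∈ V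
  · rw [ofMatchingFun, ofMatchingFun, if_pos hx, if_pos (hiff.1 hx)] at hxy
    exact opp_injective (hinj (hV.opp_mem_compl.2 hx) (hV.opp_mem_compl.2 (hiff.1 hx))
      (opp_injective hxy))
  · have hy : y ∉ V := fun h => hx (hiff.2 h)
    rw [ofMatchingFun, ofMatchingFun, if_neg hx, if_neg hy] at hxy
    exact hinj (by simpa using hx) (by simpa using hy) hxy

/-- Every matching of a transversal `V` with its complement comes from a cycle-alternating signed
permutation whose set of cycle valleys is `V`. -/
theorem exists_toMatching_eq {V : Finset (SignedIdx n)} (hV : IsTransversal V)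
    {r : SignedIdx n → SignedIdx n → Prop} (hr : ∀ p a, r p a → a < p)
    {g : SignedIdx n → SignedIdx n} (hg : g ∈ matchings r V Vᶜ) :
    ∃ π ∈ cycleAlternating n, (∀ v, π.IsCycleValley v ↔ v ∈ V) ∧
      (∀ p ∉ V, r p (π.1.symm p)) ∧ toMatching V π = g := by
  set f := ofMatchingFun V g with hf
  have hmem : ∀ p, f p ∈ V ↔ p ∉ V := ofMatchingFun_mem_iff hV hg
  have h1 : ∀ p ∉ V, f p = g p := fun p hp => by rw [hf, ofMatchingFun, if_neg hp]
  have hlt : ∀ p ∉ V, f p < p := by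
    intro p hp
    rw [h1 p hp]
    exact hr _ _ ((mem_matchings.1 hg).1 p (Finset.mem_compl.2 hp)).2
  have hgt : ∀ p ∈ V, p < f p := by
    intro p hp
    have := hlt p.opp (by rwa [hV, not_not])
    rwa [hf, ofMatchingFun_opp hV, opp_lt_opp] at this
  let F : Equiv.Perm (SignedIdx n) := Equiv.ofBijective f
    (Finite.injective_iff_bijective.1 (ofMatchingFun_injective hV hg))
  have hF : ∀ p, F p = f p := fun p => rfl
  let π : SignedPerm n := ⟨F.symm, fun i => by
    rw [Equiv.symm_apply_eq, hF, hf, ofMatchingFun_opp hV, ← hf, ← hF, Equiv.apply_symm_apply]⟩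
  have hsymm : ∀ p, π.1.symm p = f p := fun p => rfl
  have hval : ∀ v ∈ V, π.IsCycleValley v := by
    intro v hv
    refine ⟨hgt v hv, ?_⟩
    have h3 : f (π.1 v) = v := π.1.symm_apply_apply v
    have h4 := hlt (π.1 v) ((hmem _).1 (by rwa [h3]))
    rwa [h3] at h4
  have hpeak : ∀ v ∉ V, π.IsCyclePeak v := by
    intro v hv
    refine ⟨hlt v hv, ?_⟩
    have h3 : f (π.1 v) = v := π.1.symm_apply_apply v
    have h4 := hgt (π.1 v) (by
      by_contra h
      rw [← hmem, h3] at h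
      exact hv h)
    rwa [h3] at h4
  refine ⟨π, mem_cycleAlternating.2 fun i => ?_, fun v => ⟨fun h => ?_, hval v⟩, fun p hp => ?_, ?_⟩
  · by_cases hi : i ∈ V
    · exact Or.inr (hval i hi)
    · exact Or.inl (hpeak i hi)
  · by_contra hv
    exact lt_asymm (hpeak v hv).2 h.2
  · rw [hsymm, h1 p hp]
    exact ((mem_matchings.1 hg).1 p (Finset.mem_compl.2 hp)).2
  · funext p
    by_cases hp : p ∈ V
    · rw [toMatching, if_pos hp, (mem_matchings.1 hg).2.2 p (by simpa using hp)]
    · rw [toMatching, if_neg hp, hsymm, h1 p hp]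

/-- The openers counted by `matchingCode` for the closer `p` are the `j` such that the arcs ending
at `p` and starting at `j` cross. -/
theorem matchingCode_toMatching {V : Finset (SignedIdx n)}
    {r : SignedIdx n → SignedIdx n → Prop} (hlt : ∀ p a, r p a → a < p)
    (hup : ∀ p a c, r p a → a < c → c < p → r p c) {π : SignedPerm n}
    (hπ : π ∈ cycleAlternating n) (h : ∀ v, π.IsCycleValley v ↔ v ∈ V)
    (hr : ∀ p ∉ V, r p (π.1.symm p)) :
    matchingCode r V Vᶜ (toMatching V π) = π.cro := by
  classical
  have hup_mem : ∀ i, i < π.1 i → i ∈ V ∧ π.1 i ∉ V := by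
    intro i hi
    rw [mem_cycleAlternating] at hπ
    refine ⟨(h i).1 ((hπ i).resolve_left fun h' => lt_asymm h'.2 hi), fun h' => ?_⟩
    have := ((h _).2 h').1
    rw [Equiv.symm_apply_apply] at this
    exact lt_asymm this hi
  rw [matchingCode, ← Finset.card_sigma, cro]
  refine Finset.card_nbij' (fun x => (π.1.symm x.1, x.2)) (fun x => ⟨π.1 x.1, x.2⟩) ?_ ?_ ?_ ?_
  · rintro ⟨p, c⟩ hx
    simp only [Finset.coe_sigma, Set.mem_sigma_iff, Finset.mem_coe, Finset.mem_compl,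
      Finset.mem_filter] at hx
    obtain ⟨hp, hc, hrc, hgc, hfree⟩ := hx
    rw [toMatching, if_neg hp] at hgc
    simp only [Finset.mem_coe, Finset.mem_filter, Finset.mem_univ, true_and,
      Equiv.apply_symm_apply]
    refine ⟨hgc, hlt _ _ hrc, ?_⟩
    have hcv : π.1 c ∉ V := (hup_mem c ((h c).2 hc).2).2
    by_contra hcon
    rcases (not_lt.1 hcon).lt_or_eq with h' | h'
    · refine hfree (π.1 c) hcv h' ?_
      rw [toMatching, if_neg hcv, Equiv.symm_apply_apply]
    · rw [← h', Equiv.symm_apply_apply] at hgc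
      exact lt_irrefl _ hgc
  · rintro ⟨i, j⟩ hx
    simp only [Finset.mem_coe, Finset.mem_filter, Finset.mem_univ, true_and] at hx
    obtain ⟨hij, hji, hπij⟩ := hx
    have hi := hup_mem i (hij.trans hji)
    have hj := hup_mem j (hji.trans hπij)
    simp only [Finset.coe_sigma, Set.mem_sigma_iff, Finset.mem_coe, Finset.mem_compl,
      Finset.mem_filter]
    have hri := hr _ hi.2
    rw [Equiv.symm_apply_apply] at hri
    refine ⟨hi.2, hj.1, hup _ _ _ hri hij hji, ?_, fun p' hp' hlt' heq => ?_⟩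
    · rwa [toMatching, if_neg hi.2, Equiv.symm_apply_apply]
    · rw [toMatching, if_neg hp', Equiv.symm_apply_eq] at heq
      rw [heq] at hlt'
      exact lt_asymm hlt' hπij
  · rintro ⟨p, c⟩ _
    simp
  · rintro ⟨i, j⟩ _
    simp

open Classical in
theorem sum_pow_cro_eq_prod {R : Type*} [CommRing R] (q : R) {V : Finset (SignedIdx n)}
    (hV : IsTransversal V) {r : SignedIdx n → SignedIdx n → Prop}
    (hmono : ∀ a p p', p ≤ p' → r p a → r p' a) (hlt : ∀ p a, r p a → a < p)
    (hup : ∀ p a c, r p a → a < c → c < p → r p c) :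
    ∑ π ∈ cycleAlternating n with
        (∀ v, π.IsCycleValley v ↔ v ∈ V) ∧ ∀ p ∉ V, r p (π.1.symm p), q ^ π.cro =
      ∏ p ∈ Vᶜ, qInt q ((V.filter (r p)).card - (Vᶜ.filter fun p' => p' < p).card) := by
  rw [← sum_matchings q hmono]
  refine Finset.sum_bij (fun π _ => toMatching V π) (fun π hπ => ?_)
    (fun π _ ρ _ h => toMatching_injective hV h) (fun g hg => ?_) (fun π hπ => ?_)
  · rw [Finset.mem_filter] at hπ
    exact toMatching_mem hπ.1 hπ.2.1 hπ.2.2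
  · obtain ⟨π, h1, h2, h3, h4⟩ := exists_toMatching_eq hV hlt hg
    exact ⟨π, Finset.mem_filter.2 ⟨h1, h2, h3⟩, h4⟩
  · rw [Finset.mem_filter] at hπ
    rw [matchingCode_toMatching hlt hup hπ.1 hπ.2.1 hπ.2.2]

end SignedPerm

/-! ### The lattice path of a cycle-alternating signed permutation -/

namespace SignedIdx

variable {n : ℕ}

/-- The distance of `i` from the nearer end of `{-n, …, -1} ∪ {1, …, n}`, so that the elements of
level `k` are `n - k` and `-(n - k)`. -/
def level (i : SignedIdx n) : ℕ := n - (i : ℤ).natAbs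

theorem level_opp (i : SignedIdx n) : i.opp.level = i.level := by
  rw [level, coe_opp, Int.natAbs_neg, level]

theorem level_spec (i : SignedIdx n) :
    i.level < n ∧ ((i : ℤ) = n - i.level ∨ (i : ℤ) = i.level - n) := by
  have := i.coe_bounds
  rw [level]
  omega

theorem exists_neg_level {k : ℕ} (hk : k < n) :
    ∃ i : SignedIdx n, (i : ℤ) = k - n ∧ i.level = k := by
  obtain ⟨i, hi⟩ := exists_coe_eq (n := n) (z := k - n) (by omega) (by omega) (by omega)
  exact ⟨i, hi, by rw [level, hi]; omega⟩

/-- The transversal whose negative elements are those with level in `T`. -/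
noncomputable def pathTransversal (n : ℕ) (T : Finset ℕ) : Finset (SignedIdx n) :=
  Finset.univ.filter fun i => (i : ℤ) < 0 ↔ i.level ∈ T

theorem mem_pathTransversal {T : Finset ℕ} {i : SignedIdx n} :
    i ∈ pathTransversal n T ↔ ((i : ℤ) < 0 ↔ i.level ∈ T) := by
  simp [pathTransversal]

theorem isTransversal_pathTransversal (T : Finset ℕ) : IsTransversal (pathTransversal n T) := by
  intro v
  have := v.coe_bounds
  have h : ((v.opp : SignedIdx n) : ℤ) < 0 ↔ ¬ (v : ℤ) < 0 := by
    rw [coe_opp]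
    omega
  rw [mem_pathTransversal, mem_pathTransversal, level_opp, h]
  tauto

theorem card_filter_pathTransversal {T : Finset ℕ} (hT : T ⊆ Finset.range n) (e : ℕ) {i : ℕ}
    (hi : i ≤ n) :
    ((pathTransversal n T).filter fun c : SignedIdx n => (c : ℤ) < i - n ∧ (e : ℤ) - n ≤ c).card =
      upCount T e i := by
  refine Finset.card_bij (fun c _ => c.level) (fun c hc => ?_) (fun c hc d hd h => ?_)
    (fun j hj => ?_)
  · simp only [Finset.mem_filter, mem_pathTransversal] at hc ⊢
    have := c.level_spec
    refine ⟨hc.1.1 (by omega), by omega, by omega⟩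
  · simp only [Finset.mem_filter] at hc hd
    have := c.level_spec
    have := d.level_spec
    apply Subtype.ext
    omega
  · rw [Finset.mem_filter] at hj
    obtain ⟨c, hc, hcl⟩ := exists_neg_level (Finset.mem_range.1 (hT hj.1))
    refine ⟨c, ?_, hcl⟩
    rw [Finset.mem_filter, mem_pathTransversal, hcl, hc]
    exact ⟨⟨fun _ => hj.1, fun _ => by omega⟩, by omega, by omega⟩

theorem card_filter_compl_pathTransversal {T : Finset ℕ} {i : ℕ} (hi : i ≤ n) :
    ((pathTransversal n T)ᶜ.filter fun c : SignedIdx n => (c : ℤ) < i - n).card = downCount T i := by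
  refine Finset.card_bij (fun c _ => c.level) (fun c hc => ?_) (fun c hc d hd h => ?_)
    (fun j hj => ?_)
  · simp only [Finset.mem_filter, Finset.mem_compl, mem_pathTransversal, Finset.mem_range] at hc ⊢
    have := c.level_spec
    refine ⟨by omega, fun h => hc.1 ⟨fun _ => h, fun _ => by omega⟩⟩
  · simp only [Finset.mem_filter] at hc hd
    have := c.level_spec
    have := d.level_spec
    apply Subtype.ext
    omega
  · rw [Finset.mem_filter, Finset.mem_range] at hj
    obtain ⟨c, hc, hcl⟩ := exists_neg_level (hj.1.trans_le hi)
    refine ⟨c, ?_, hcl⟩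
    rw [Finset.mem_filter, Finset.mem_compl, mem_pathTransversal, hcl, hc]
    exact ⟨fun h => hj.2 (h.1 (by omega)), by omega⟩

theorem IsTransversal.card_filter_opp {V : Finset (SignedIdx n)} (hV : IsTransversal V)
    (s : ℤ → Prop) [DecidablePred s] [DecidablePred fun z => s (-z)] :
    (V.filter fun c : SignedIdx n => s c).card =
      (Vᶜ.filter fun c : SignedIdx n => s (-(c : ℤ))).card := by
  refine Finset.card_nbij' opp opp (fun c hc => ?_) (fun c hc => ?_) (fun c _ => opp_opp c)
    (fun c _ => opp_opp c)
  · simp only [Finset.mem_coe, Finset.mem_filter] at hc ⊢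
    exact ⟨hV.opp_mem_compl.2 hc.1, by rw [coe_opp, neg_neg]; exact hc.2⟩
  · simp only [Finset.mem_coe, Finset.mem_filter, Finset.mem_compl] at hc ⊢
    exact ⟨(hV c).2 hc.1, by rw [coe_opp]; exact hc.2⟩

/-- Admissibility of the opener `a` for the closer `p`: the arc goes to the right and, if `p` is
negative, `a` is not among the `e` smallest elements. -/
def Admissible (e : ℕ) (p a : SignedIdx n) : Prop :=
  a < p ∧ ((p : ℤ) < 0 → (e : ℤ) - n ≤ a)

theorem Admissible.mono {e : ℕ} (a p p' : SignedIdx n) (h : p ≤ p') (ha : Admissible e p a) :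
    Admissible e p' a :=
  ⟨ha.1.trans_le h, fun h' => ha.2 (lt_of_le_of_lt (Subtype.coe_le_coe.2 h) h')⟩

theorem Admissible.of_lt {e : ℕ} (p a c : SignedIdx n) (ha : Admissible e p a) (h : a < c)
    (hc : c < p) : Admissible e p c :=
  ⟨hc, fun h' => (ha.2 h').trans (Subtype.coe_le_coe.2 h.le)⟩

open Classical in
/-- The number of choices for the closer of level `i` is the one occurring in `stepWeight`. For a
negative closer this counts elements to its left. For a positive closer, the elements to its left
are the complement of those to its right, which correspond by `c ↦ -c` to elements on the left. -/
theorem qInt_choices_eq_stepWeight {R : Type*} [CommRing R] (q : R) (e : ℕ) {T : Finset ℕ}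
    (hT : T ⊆ Finset.range n) {p : SignedIdx n} (hp : p ∈ (pathTransversal n T)ᶜ) :
    qInt q (((pathTransversal n T).filter (Admissible e p)).card -
        ((pathTransversal n T)ᶜ.filter fun p' => p' < p).card) = stepWeight q e T p.level := by
  set V := pathTransversal n T with hVdef
  have hV : IsTransversal V := isTransversal_pathTransversal T
  have hpl := p.level_spec
  set i := p.level with hi
  rw [Finset.mem_compl, mem_pathTransversal, ← hi] at hp
  by_cases hneg : (p : ℤ) < 0
  · have hpi : (p : ℤ) = i - n := by omega
    have hiT : i ∉ T := fun h => hp ⟨fun _ => h, fun _ => hneg⟩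
    rw [stepWeight, if_neg hiT, ← card_filter_pathTransversal hT e hpl.1.le,
      ← card_filter_compl_pathTransversal (n := n) hpl.1.le, ← hVdef]
    congr 3
    · refine Finset.filter_congr fun c _ => ?_
      rw [Admissible, ← Subtype.coe_lt_coe, hpi]
      exact and_congr_right fun _ => ⟨fun h => h (by omega), fun h _ => h⟩
    · refine Finset.filter_congr fun c _ => ?_
      rw [← Subtype.coe_lt_coe, hpi]
  · have hpi : (p : ℤ) = n - i := by omega
    have hiT : i ∈ T := by
      by_contra h
      exact hp ⟨fun h' => absurd h' hneg, fun h' => absurd h' h⟩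
    have hu := upCount_succ T (Nat.zero_le i)
    have hd := downCount_succ T i
    rw [if_pos hiT] at hu hd
    rw [← card_filter_pathTransversal hT 0 (i := i + 1) hpl.1, ← hVdef] at hu
    rw [← card_filter_compl_pathTransversal (n := n) (i := i + 1) hpl.1, ← hVdef] at hd
    have e1 : (V.filter (Admissible e p)) = V.filter fun c : SignedIdx n => (c : ℤ) < n - i := by
      refine Finset.filter_congr fun c _ => ?_
      rw [Admissible, ← Subtype.coe_lt_coe, hpi]
      exact ⟨fun h => h.1, fun h => ⟨h, fun h' => absurd h' (by omega)⟩⟩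
    have e2 : (Vᶜ.filter fun p' => p' < p) = Vᶜ.filter fun c : SignedIdx n => (c : ℤ) < n - i := by
      refine Finset.filter_congr fun c _ => ?_
      rw [← Subtype.coe_lt_coe, hpi]
    have hc := hV.card_filter_opp fun _ => True
    simp only [Finset.filter_true] at hc
    have h1 := V.card_filter_add_card_filter_not fun c : SignedIdx n => (c : ℤ) < n - i
    have h2 := Vᶜ.card_filter_add_card_filter_not fun c : SignedIdx n => (c : ℤ) < n - i
    have h3 : (V.filter fun c : SignedIdx n => ¬ (c : ℤ) < n - i).card =
        (Vᶜ.filter fun c : SignedIdx n => (c : ℤ) < (i + 1 : ℕ) - n).card := by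
      rw [hV.card_filter_opp fun z => ¬ z < n - i]
      congr 1
      refine Finset.filter_congr fun c _ => ?_
      omega
    have h4 : (Vᶜ.filter fun c : SignedIdx n => ¬ (c : ℤ) < n - i).card =
        (V.filter fun c : SignedIdx n => (c : ℤ) < (i + 1 : ℕ) - n ∧ ((0 : ℕ) : ℤ) - n ≤ c).card := by
      rw [hV.card_filter_opp fun z => z < (i + 1 : ℕ) - n ∧ ((0 : ℕ) : ℤ) - n ≤ z]
      congr 1
      refine Finset.filter_congr fun c _ => ?_
      have := c.coe_bounds
      omega
    rw [stepWeight, if_pos hiT, e1, e2]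
    congr 1
    omega

open Classical in
theorem prod_qInt_choices_eq_pathWeight {R : Type*} [CommRing R] (q : R) (e : ℕ) {T : Finset ℕ}
    (hT : T ⊆ Finset.range n) :
    ∏ p ∈ (pathTransversal n T)ᶜ, qInt q (((pathTransversal n T).filter (Admissible e p)).card -
        ((pathTransversal n T)ᶜ.filter fun p' => p' < p).card) = pathWeight q e n T := by
  refine Finset.prod_bij (fun p _ => p.level) (fun p _ => Finset.mem_range.2 p.level_spec.1)
    (fun x hx y hy h => ?_) (fun i hi => ?_) (fun p hp => qInt_choices_eq_stepWeight q e hT hp)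
  · rw [Finset.mem_compl, mem_pathTransversal] at hx hy
    have h1 := x.level_spec
    have h2 := y.level_spec
    have h3 := x.coe_bounds
    have h4 := y.coe_bounds
    rw [h] at hx h1
    have h5 : (x : ℤ) < 0 ↔ (y : ℤ) < 0 := by tauto
    apply Subtype.ext
    omega
  · obtain ⟨c, -, hcl⟩ := exists_neg_level (Finset.mem_range.1 hi)
    by_cases hc : c ∈ pathTransversal n T
    · exact ⟨c.opp, (isTransversal_pathTransversal T).opp_mem_compl.2 hc, by rw [level_opp, hcl]⟩
    · exact ⟨c, Finset.mem_compl.2 hc, hcl⟩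

end SignedIdx

namespace SignedPerm

open SignedIdx

variable {n : ℕ}

/-- The levels of the negative cycle valleys of `π`. -/
noncomputable def upSteps (π : SignedPerm n) : Finset ℕ :=
  (Finset.univ.filter fun i : SignedIdx n => (i : ℤ) < 0 ∧ π.IsCycleValley i).image level

theorem upSteps_subset (π : SignedPerm n) : π.upSteps ⊆ Finset.range n := by
  intro k hk
  rw [upSteps, Finset.mem_image] at hk
  obtain ⟨i, -, rfl⟩ := hk
  exact Finset.mem_range.2 i.level_spec.1

theorem level_mem_upSteps {π : SignedPerm n} {i : SignedIdx n} (hi : (i : ℤ) < 0) :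
    i.level ∈ π.upSteps ↔ π.IsCycleValley i := by
  rw [upSteps, Finset.mem_image]
  constructor
  · rintro ⟨j, hj, hji⟩
    simp only [Finset.mem_filter, Finset.mem_univ, true_and] at hj
    have h1 := i.level_spec
    have h2 := j.level_spec
    have h3 : j = i := Subtype.ext (by omega)
    exact h3 ▸ hj.2
  · intro h
    exact ⟨i, by simpa using ⟨hi, h⟩, rfl⟩

theorem isCycleValley_opp_iff {π : SignedPerm n} (hπ : π ∈ cycleAlternating n)
    (i : SignedIdx n) : π.IsCycleValley i.opp ↔ ¬ π.IsCycleValley i := by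
  have h : π.IsCycleValley i.opp ↔ π.IsCyclePeak i := by
    rw [IsCycleValley, symm_opp, π.2, gt_iff_lt, opp_lt_opp, opp_lt_opp]
  rw [h]
  refine ⟨fun h1 h2 => lt_asymm h1.1 h2.1, fun h' => ?_⟩
  exact (mem_cycleAlternating.1 hπ i).resolve_right h'

theorem isCycleValley_iff_mem_pathTransversal {π : SignedPerm n} (hπ : π ∈ cycleAlternating n)
    (v : SignedIdx n) : π.IsCycleValley v ↔ v ∈ pathTransversal n π.upSteps := by
  have hneg : ∀ v : SignedIdx n, (v : ℤ) < 0 →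
      (π.IsCycleValley v ↔ v ∈ pathTransversal n π.upSteps) := by
    intro v hv
    rw [mem_pathTransversal, level_mem_upSteps hv]
    exact ⟨fun h => ⟨fun _ => h, fun _ => hv⟩, fun h => h.1 hv⟩
  by_cases hv : (v : ℤ) < 0
  · exact hneg v hv
  · have h0 := v.coe_bounds
    have := hneg v.opp (by rw [coe_opp]; omega)
    rw [isCycleValley_opp_iff hπ, isTransversal_pathTransversal] at this
    exact not_iff_not.1 this

theorem upSteps_eq_iff {π : SignedPerm n} (hπ : π ∈ cycleAlternating n) {T : Finset ℕ}
    (hT : T ⊆ Finset.range n) :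
    π.upSteps = T ↔ ∀ v, π.IsCycleValley v ↔ v ∈ pathTransversal n T := by
  constructor
  · rintro rfl
    exact isCycleValley_iff_mem_pathTransversal hπ
  · intro h
    ext k
    by_cases hk : k < n
    · obtain ⟨c, hc, rfl⟩ := exists_neg_level hk
      have hc0 : (c : ℤ) < 0 := by omega
      rw [level_mem_upSteps hc0, h, mem_pathTransversal]
      exact ⟨fun h => h.1 hc0, fun h => ⟨fun _ => h, fun _ => hc0⟩⟩
    · exact ⟨fun h' => absurd (Finset.mem_range.1 (π.upSteps_subset h')) hk,
        fun h' => absurd (Finset.mem_range.1 (hT h')) hk⟩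

/-- `π` maps the positive cycle peaks with positive image onto the positive cycle valleys, so the
positive cycle peaks with negative image are counted by the difference of the numbers of up-steps
and down-steps. -/
theorem neg_add_downCount {π : SignedPerm n} (hπ : π ∈ cycleAlternating n) :
    π.neg + downCount π.upSteps n = upCount π.upSteps 0 n := by
  classical
  set V := pathTransversal n π.upSteps with hVdef
  have hval : ∀ v, π.IsCycleValley v ↔ v ∈ V := isCycleValley_iff_mem_pathTransversal hπ
  have hV : IsTransversal V := isTransversal_pathTransversal _
  have hpv := mem_cycleAlternating.1 hπ
  have hpeak : ∀ i ∉ V, π.1 i < i := fun i hi =>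
    ((hpv i).resolve_right fun h => hi ((hval i).1 h)).2
  rw [← card_filter_pathTransversal π.upSteps_subset 0 le_rfl,
    ← card_filter_compl_pathTransversal (n := n) le_rfl, ← hVdef]
  have h1 : (V.filter fun c : SignedIdx n => (c : ℤ) < n - n ∧ ((0 : ℕ) : ℤ) - n ≤ c).card =
      (Vᶜ.filter fun c : SignedIdx n => 0 < (c : ℤ)).card := by
    rw [hV.card_filter_opp fun z => z < n - n ∧ ((0 : ℕ) : ℤ) - n ≤ z]
    congr 1
    refine Finset.filter_congr fun c _ => ?_
    have := c.coe_bounds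
    omega
  have h2 : (Vᶜ.filter fun c : SignedIdx n => (c : ℤ) < n - n).card =
      (V.filter fun c : SignedIdx n => 0 < (c : ℤ)).card := by
    rw [hV.card_filter_opp fun z => 0 < z]
    congr 1
    refine Finset.filter_congr fun c _ => ?_
    omega
  rw [h1, h2, ← (Vᶜ.filter fun c : SignedIdx n => 0 < (c : ℤ)).card_filter_add_card_filter_not
    fun c => (π.1 c : ℤ) < 0]
  congr 1
  · rw [neg, Finset.filter_filter]
    congr 1
    ext i
    simp only [Finset.mem_filter, Finset.mem_univ, true_and, Finset.mem_compl]
    refine ⟨fun h => ⟨fun hi => ?_, h⟩, fun h => h.2⟩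
    have := Subtype.coe_lt_coe.2 ((hval i).2 hi).2
    omega
  · refine Finset.card_nbij' π.1.symm π.1 (fun v hv => ?_) (fun c hc => ?_) (fun _ _ => by simp)
      (fun _ _ => by simp)
    · simp only [Finset.mem_coe, Finset.mem_filter, Finset.mem_compl] at hv ⊢
      have hlt : v < π.1.symm v := ((hval v).2 hv.1).1
      have hlt' := Subtype.coe_lt_coe.2 hlt
      refine ⟨⟨fun h => ?_, by omega⟩, by rw [Equiv.apply_symm_apply]; omega⟩
      have := ((hval _).2 h).2
      rw [Equiv.apply_symm_apply] at this
      exact lt_asymm this hlt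
    · simp only [Finset.mem_coe, Finset.mem_filter, Finset.mem_compl] at hc ⊢
      have h0 := (π.1 c).coe_bounds
      refine ⟨(hval _).1 ((hpv _).resolve_left fun h => ?_), by omega⟩
      have := h.1
      rw [Equiv.symm_apply_apply] at this
      exact lt_asymm this (hpeak c hc.1.1)

open Classical in
/-- Summing over the sets of cycle valleys expresses the generating polynomial of the
cycle-alternating signed permutations with admissible arcs as a generating polynomial of paths. -/
theorem sum_admissible_eq_pathPoly {R : Type*} [CommRing R] (q : R) (n e : ℕ) :
    ∑ π ∈ cycleAlternating n with ∀ p, ¬ π.IsCycleValley p → Admissible e p (π.1.symm p),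
        (X : R[X]) ^ (π.neg - e) * C (q ^ π.cro) = pathPoly q e n := by
  rw [pathPoly, ← Finset.sum_fiberwise_of_maps_to (g := upSteps)
    (t := (Finset.range n).powerset) fun π _ => Finset.mem_powerset.2 π.upSteps_subset]
  refine Finset.sum_congr rfl fun T hT => ?_
  rw [Finset.mem_powerset] at hT
  have h1 : ∀ π ∈ ((cycleAlternating n).filter fun π =>
      ∀ p, ¬ π.IsCycleValley p → Admissible e p (π.1.symm p)).filter fun π => π.upSteps = T,
      (X : R[X]) ^ (π.neg - e) * C (q ^ π.cro) =
        X ^ (upCount T 0 n - downCount T n - e) * C (q ^ π.cro) := by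
    intro π hπ
    simp only [Finset.mem_filter] at hπ
    have := neg_add_downCount hπ.1.1
    rw [hπ.2] at this
    rw [← this, Nat.add_sub_cancel]
  rw [Finset.sum_congr rfl h1, ← Finset.mul_sum, mul_comm, ← map_sum]
  congr 2
  rw [← prod_qInt_choices_eq_pathWeight q e hT, ← sum_pow_cro_eq_prod q
    (isTransversal_pathTransversal T) Admissible.mono (fun p a h => h.1) Admissible.of_lt]
  refine Finset.sum_congr ?_ fun _ _ => rfl
  ext π
  simp only [Finset.mem_filter]
  constructor
  · rintro ⟨⟨h1, h2⟩, h3⟩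
    have h4 := (upSteps_eq_iff h1 hT).1 h3
    exact ⟨h1, h4, fun p hp => h2 p fun h => hp ((h4 p).1 h)⟩
  · rintro ⟨h1, h2, h3⟩
    exact ⟨⟨h1, fun p hp => h3 p fun h => hp ((h2 p).2 h)⟩, (upSteps_eq_iff h1 hT).2 h2⟩

theorem admissible_zero {π : SignedPerm n} (hπ : π ∈ cycleAlternating n) {p : SignedIdx n}
    (hp : ¬ π.IsCycleValley p) : Admissible 0 p (π.1.symm p) := by
  refine ⟨((mem_cycleAlternating.1 hπ p).resolve_right hp).1, fun _ => ?_⟩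
  have := (π.1.symm p).coe_bounds
  omega

/-- The largest element is mapped to a negative one exactly when the arc starting at the smallest
element ends at a positive one. -/
theorem admissible_one_iff {π : SignedPerm (n + 1)} (hπ : π ∈ cycleAlternating (n + 1)) :
    (∀ p, ¬ π.IsCycleValley p → Admissible 1 p (π.1.symm p)) ↔
      (π.1 (top n) : ℤ) < 0 := by
  have htop : ((top n : SignedIdx (n + 1)) : ℤ) = n + 1 := by simp [top]
  have hp0 : (π.1 (top n).opp : ℤ) = -(π.1 (top n) : ℤ) := by rw [π.2, coe_opp]
  constructor
  · intro h
    by_contra hcon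
    have hb := (π.1 (top n)).coe_bounds
    have hnv : ¬ π.IsCycleValley (π.1 (top n).opp) := by
      intro hv
      have := Subtype.coe_lt_coe.2 hv.1
      have hb' := (π.1 (top n).opp).coe_bounds
      rw [Equiv.symm_apply_apply, coe_opp, htop] at this
      push_cast at hb'
      omega
    have := (h _ hnv).2 (by omega)
    rw [Equiv.symm_apply_apply, coe_opp, htop] at this
    push_cast at this
    omega
  · intro h p hp
    refine ⟨((mem_cycleAlternating.1 hπ p).resolve_right hp).1, fun hneg => ?_⟩
    have hb := (π.1.symm p).coe_bounds
    by_contra hcon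
    have h1 : π.1.symm p = (top n).opp := by
      apply Subtype.ext
      rw [coe_opp, htop]
      push_cast at hb hcon
      omega
    rw [Equiv.symm_apply_eq] at h1
    rw [← h1] at hp0
    omega

/-! ### Inversion of cycle-alternating signed permutations -/

/-- The inverse signed permutation. -/
def symm (π : SignedPerm n) : SignedPerm n :=
  ⟨π.1.symm, π.symm_opp⟩

theorem symm_mem_cycleAlternating {π : SignedPerm n} (hπ : π ∈ cycleAlternating n) :
    π.symm ∈ cycleAlternating n := by
  rw [mem_cycleAlternating] at hπ ⊢
  exact fun i => (hπ i).imp (fun h => ⟨h.2, h.1⟩) fun h => ⟨h.2, h.1⟩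

/-- If `i` is positive and `π i` negative, then `-π i` is positive and mapped to `-i` by the
inverse of `π`. -/
theorem neg_symm (π : SignedPerm n) : π.symm.neg = π.neg := by
  refine Finset.card_nbij' (fun i => (π.1.symm i).opp) (fun i => (π.1 i).opp)
    (fun i hi => ?_) (fun i hi => ?_) (fun i _ => ?_) (fun i _ => ?_)
  · rw [Finset.mem_coe, Finset.mem_filter] at hi ⊢
    simp only [Finset.mem_univ, true_and, symm] at hi ⊢
    rw [π.2, Equiv.apply_symm_apply, coe_opp, coe_opp]
    omega
  · rw [Finset.mem_coe, Finset.mem_filter] at hi ⊢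
    simp only [Finset.mem_univ, true_and, symm] at hi ⊢
    rw [symm_opp, Equiv.symm_apply_apply, coe_opp, coe_opp]
    omega
  · dsimp only
    rw [π.2, Equiv.apply_symm_apply, opp_opp]
  · dsimp only
    rw [symm_opp, Equiv.symm_apply_apply, opp_opp]

/-- The rotation `i ↦ -i` carries the increasing arcs of the inverse of `π` to those of `π`. -/
theorem cro_symm (π : SignedPerm n) : π.symm.cro = π.cro := by
  refine Finset.card_nbij' (fun x => ((π.1.symm x.2).opp, (π.1.symm x.1).opp))
    (fun x => ((π.1 x.2).opp, (π.1 x.1).opp)) ?_ ?_ ?_ ?_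
  · rintro ⟨i, j⟩ h
    rw [Finset.mem_coe, Finset.mem_filter] at h ⊢
    simp only [Finset.mem_univ, true_and, symm] at h ⊢
    rw [π.2, π.2, Equiv.apply_symm_apply, Equiv.apply_symm_apply, opp_lt_opp, opp_lt_opp,
      opp_lt_opp]
    exact ⟨h.2.2, h.2.1, h.1⟩
  · rintro ⟨i, j⟩ h
    rw [Finset.mem_coe, Finset.mem_filter] at h ⊢
    simp only [Finset.mem_univ, true_and, symm] at h ⊢
    rw [symm_opp, symm_opp, Equiv.symm_apply_apply, Equiv.symm_apply_apply, opp_lt_opp,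
      opp_lt_opp, opp_lt_opp]
    exact ⟨h.2.2, h.2.1, h.1⟩
  · rintro ⟨i, j⟩ _
    simp [π.2, opp_opp]
  · rintro ⟨i, j⟩ _
    simp [symm_opp, opp_opp]

end SignedPerm

theorem mainTheorem4 {R : Type*} [CommRing R] (q : R) (n : ℕ) :
    qPolyQ q n =
        ∑ π ∈ SignedPerm.cycleAlternating n, (X : R[X]) ^ π.neg * C (q ^ π.cro) ∧
    qPolyR q n =
        ∑ π ∈ SignedPerm.cycleAlternating (n + 1) with (π.1 (SignedIdx.top n) : ℤ) < 0,
          (X : R[X]) ^ (π.neg - 1) * C (q ^ π.cro) ∧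
    qPolyR q n =
        ∑ π ∈ SignedPerm.cycleAlternating (n + 1) with (π.1.symm (SignedIdx.top n) : ℤ) < 0,
          (X : R[X]) ^ (π.neg - 1) * C (q ^ π.cro) := by
  have hR : qPolyR q n =
      ∑ π ∈ SignedPerm.cycleAlternating (n + 1) with (π.1 (SignedIdx.top n) : ℤ) < 0,
        (X : R[X]) ^ (π.neg - 1) * C (q ^ π.cro) := by
    classical
    rw [← pathPoly_one_eq_qPolyR, ← SignedPerm.sum_admissible_eq_pathPoly]
    refine Finset.sum_congr ?_ fun _ _ => rfl
    exact Finset.filter_congr fun π hπ => SignedPerm.admissible_one_iff hπ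
  refine ⟨?_, hR, hR.trans ?_⟩
  · classical
    rw [← pathPoly_zero_eq_qPolyQ, ← SignedPerm.sum_admissible_eq_pathPoly,
      Finset.filter_true_of_mem fun π hπ p hp => SignedPerm.admissible_zero hπ hp]
    rfl
  · refine Finset.sum_nbij' SignedPerm.symm SignedPerm.symm (fun π hπ => ?_) (fun π hπ => ?_)
      (fun _ _ => rfl) (fun _ _ => rfl) (fun π _ => ?_)
    · rw [Finset.mem_filter] at hπ ⊢
      exact ⟨SignedPerm.symm_mem_cycleAlternating hπ.1, hπ.2⟩
    · rw [Finset.mem_filter] at hπ ⊢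
      exact ⟨SignedPerm.symm_mem_cycleAlternating hπ.1, hπ.2⟩
    · rw [SignedPerm.neg_symm, SignedPerm.cro_symm]
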